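/- Let $a<b$ and let $V:[a,b]\to\mathbb{R}$ be measurable and bounded below. Put $I_y=\{x\in[a,b]: V(x)\le y\}$, $w_V(y)=|I_y|$ (Lebesgue measure), $m=\inf_{[a,b]}V$ and $$ M \;=\; \inf_{y>m}\left(\frac{1}{w_V(y)^2}+y\right), \qquad \tfrac10=+\infty .$$ Consider the operator $-\frac{d^2}{dx^2}+V$ on $[a,b]$ with Dirichlet boundary conditions, defined through its quadratic form $\int_a^b (f'^2+Vf^2)\,dx$ on the form domain $\{f\in H^1_0(a,b):\int_a^b |V| f^2\,dx<\infty\}$. If this form domain is not $\{0\}$, the operator has a smallest eigenvalue. Let $\lambda_1$ be the smallest eigenvalue. (i) If $V\ge 0$ on $[a,b]$, then $\lambda_1\ge \frac{1}{250}\,M$. If moreover $I_{y^*}$ is an interval for some $y^*$ solving the minimization problem (that is, $w_V(y^*)>0$ and $\frac{1}{w_V(y^*)^2}+y^*=M$), then $\lambda_1\le \pi^2 M$. Every eigenfunction $f$ for $\lambda_1$ with $\int_a^b f^2\,dx=1$ satisfies $\|f\|_\infty\le (2\lambda_1)^{1/4}$. (ii) For every $V$ that is bounded below, without a sign condition, $\lambda_1-m\ge\frac1{250}\,(M-m)$,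 and if $I_{y^*}$ is an interval for some $y^*$ as in (i), then $\lambda_1-m\le \pi^2\,(M-m)$. -/

import Mathlib

open MeasureTheory Set

noncomputable section

namespace DirichletSchrodinger

/-- The sublevel set `I_y = {x ∈ [a,b] : V x ≤ y}`. -/
def sublevel (a b : ℝ) (V : ℝ → ℝ) (y : ℝ) : Set ℝ := {x | x ∈ Icc a b ∧ V x ≤ y}

/-- `w_V(y) = |I_y|`, the length of the sublevel set. -/
def width (a b : ℝ) (V : ℝ → ℝ) (y : ℝ) : ℝ := (volume (sublevel a b V y)).toReal

/-- The infimum of `V` on `[a,b]`. -/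
def infV (a b : ℝ) (V : ℝ → ℝ) : ℝ := sInf (V '' Icc a b)

/-- The values `1 / w_V(y)² + y` for `y > inf V`. Levels with `w_V(y) = 0`, where the value is
`+∞`, do not contribute to the infimum and are left out. -/
def widthValues (a b : ℝ) (V : ℝ → ℝ) : Set ℝ :=
  {z | ∃ y, infV a b V < y ∧ 0 < width a b V y ∧ z = 1 / width a b V y ^ 2 + y}

/-- The minimum (as an infimum) of `1 / w_V(y)² + y` over `y > inf V`. -/
def widthMin (a b : ℝ) (V : ℝ → ℝ) : ℝ := sInf (widthValues a b V)

/-- `y` solves the minimization problem: `1 / w_V(y)² + y` is finite and equals the minimum. (A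
level with `w_V(y) > 0` satisfies `y ≥ inf V`; the endpoint `y = inf V` is allowed.) -/
def IsMinimizingLevel (a b : ℝ) (V : ℝ → ℝ) (y : ℝ) : Prop :=
  0 < width a b V y ∧ 1 / width a b V y ^ 2 + y = widthMin a b V

/-- The form domain of `-d²/dx² + V` on `[a,b]` with Dirichlet conditions: the functions in
`H¹₀(a,b)` (absolutely continuous, with square integrable derivative, vanishing at both
endpoints) for which `V f²` is integrable. -/
structure InFormDomain (a b : ℝ) (V : ℝ → ℝ) (f : ℝ → ℝ) : Prop where
  absCont : AbsolutelyContinuousOnInterval f a b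
  left : f a = 0
  right : f b = 0
  deriv_memLp : MemLp (deriv f) 2 (volume.restrict (Icc a b))
  potential : IntegrableOn (fun x => V x * f x ^ 2) (Icc a b)

/-- `f` is an eigenfunction of the Dirichlet operator `-d²/dx² + V` on `[a,b]` with eigenvalue
`μ`: a nonzero weak solution of `-f'' + V f = μ f` in the form domain. -/
def IsEigenfunction (a b : ℝ) (V : ℝ → ℝ) (μ : ℝ) (f : ℝ → ℝ) : Prop :=
  InFormDomain a b V f ∧ (∃ x ∈ Icc a b, f x ≠ 0) ∧
    ∀ g : ℝ → ℝ, InFormDomain a b V g →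
      ∫ x in Icc a b, (deriv f x * deriv g x + V x * f x * g x) =
        μ * ∫ x in Icc a b, f x * g x

/-- The eigenvalues of the Dirichlet operator `-d²/dx² + V` on `[a,b]`. -/
def eigenvalues (a b : ℝ) (V : ℝ → ℝ) : Set ℝ := {μ | ∃ f, IsEigenfunction a b V μ f}

end DirichletSchrodinger

end

/-!
# Eigenvalue bounds for Dirichlet Schrödinger operators by widths of sublevel sets

Write `E(f) = ∫ (f'² + V f²)` and `m = inf V`.

**Existence of the least eigenvalue.** Minimize `E` over the normalized functions of the form
domain. A minimizing sequence has derivatives bounded in `L²`, hence is uniformly Hölder continuous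
of exponent `1/2`, and by Arzelà–Ascoli a subsequence converges uniformly
(`exists_subseq_tendstoUniformlyOn`). No weak compactness is needed to pass to the limit: by the
parallelogram law, `E((fₙ - fₖ)/2)` is the mean of `E(fₙ)` and `E(fₖ)` minus `E((fₙ + fₖ)/2)`, and
the midpoint is almost normalized, so that its energy is almost at least the infimum. Hence the
derivatives are Cauchy in `L²`; the limit is found as the primitive of their `L²` limit, and Fatou's
lemma handles the potential term (`exists_formDomain_limit`). The first variation shows that
the minimizer is an eigenfunction, and testing the equation of any eigenfunction with itself shows
that the minimum is the least eigenvalue (`exists_isLeast_eigenvalues`).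

**Lower bound.** A function of the form domain satisfies `‖f‖_∞⁴ ≤ ‖f‖² ‖f'‖²`
(`InFormDomain.pow_four_le`). For a normalized eigenfunction with eigenvalue `μ` this gives
`‖f‖_∞² ≤ √(μ - m)`. At most half of its mass lies where `V - m > 2 (μ - m)`, so
`1/2 ≤ √(μ - m) * w` with `w` the width at the level `m + 2 (μ - m)`. Therefore
`1 / w² + (m + 2 (μ - m)) ≤ m + 6 (μ - m)`, which is better than the required constant `250`
(`widthMin_sub_infV_le`).

**Upper bound.** If the sublevel set at `y` is an interval of length `w`, the first Dirichlet
eigenfunction of the Laplacian on that interval, extended by zero, has Rayleigh quotient at most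
`π² / w² + y` (`energy_sineBump_le`), and `m ≤ y` allows replacing `y - m` by `π² (y - m)`.

The bounds for `V ≥ 0` follow from those measured from `m`, because then `m ≥ 0`.
-/

namespace DirichletSchrodinger

open Filter Topology

/-! ### Cauchy–Schwarz in integral form -/

lemma integral_comb_three {α : Type*} [MeasurableSpace α] {μ : Measure α} {u v w : α → ℝ}
    (hu : Integrable u μ) (hv : Integrable v μ) (hw : Integrable w μ) (r s t : ℝ) :
    ∫ x, (r * u x + s * v x + t * w x) ∂μ
      = r * ∫ x, u x ∂μ + s * ∫ x, v x ∂μ + t * ∫ x, w x ∂μ := by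
  have huv : Integrable (fun x => r * u x + s * v x) μ := (hu.const_mul r).add (hv.const_mul s)
  rw [integral_add huv (hw.const_mul t), integral_add (hu.const_mul r) (hv.const_mul s),
    integral_const_mul, integral_const_mul, integral_const_mul]

/-- **Cauchy–Schwarz** for real square-integrable functions. -/
lemma sq_integral_mul_le {α : Type*} [MeasurableSpace α] {μ : Measure α} {f g : α → ℝ}
    (hf : MemLp f 2 μ) (hg : MemLp g 2 μ) :
    (∫ x, f x * g x ∂μ) ^ 2 ≤ (∫ x, f x ^ 2 ∂μ) * ∫ x, g x ^ 2 ∂μ := by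
  have hfg : Integrable (fun x => f x * g x) μ := hf.integrable_mul hg
  have key : ∀ t : ℝ, 0 ≤ (∫ x, f x ^ 2 ∂μ) * (t * t) + (2 * ∫ x, f x * g x ∂μ) * t
      + ∫ x, g x ^ 2 ∂μ := by
    intro t
    have h : ∫ x, (t * f x + g x) ^ 2 ∂μ = (∫ x, f x ^ 2 ∂μ) * (t * t)
        + (2 * ∫ x, f x * g x ∂μ) * t + ∫ x, g x ^ 2 ∂μ := by
      have e := integral_comb_three hf.integrable_sq hfg hg.integrable_sq (t * t) (2 * t) 1
      rw [one_mul] at e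
      convert! e using 2
      · ext x; ring
      · ring
    rw [← h]
    exact integral_nonneg fun x => sq_nonneg _
  have := discrim_le_zero key
  rw [discrim] at this
  nlinarith

/-! ### The form domain and its quadratic forms -/

/-- The bilinear form `∫ (f' g' + V f g)` of the operator `-d²/dx² + V`. -/
noncomputable def energy (a b : ℝ) (V f g : ℝ → ℝ) : ℝ :=
  ∫ x in Icc a b, (deriv f x * deriv g x + V x * f x * g x)

/-- The `L²(a,b)` inner product of two real functions. -/
noncomputable def overlap (a b : ℝ) (f g : ℝ → ℝ) : ℝ := ∫ x in Icc a b, f x * g x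

variable {a b : ℝ} {V f g : ℝ → ℝ}

lemma overlap_self_eq : overlap a b f f = ∫ x in Icc a b, f x ^ 2 := by
  simp only [overlap, sq]

lemma overlap_self_nonneg : 0 ≤ overlap a b f f :=
  integral_nonneg fun _ => mul_self_nonneg _

namespace InFormDomain

lemma continuousOn (hab : a ≤ b) (hf : InFormDomain a b V f) : ContinuousOn f (Icc a b) := by
  simpa [uIcc_of_le hab] using hf.absCont.continuousOn

lemma memLp_two (hab : a ≤ b) (hf : InFormDomain a b V f) :
    MemLp f 2 (volume.restrict (Icc a b)) := by
  have hc := hf.continuousOn hab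
  obtain ⟨C, hC⟩ := isCompact_Icc.exists_bound_of_continuousOn hc
  refine MemLp.of_bound (hc.aestronglyMeasurable measurableSet_Icc) C ?_
  rw [ae_restrict_iff' measurableSet_Icc]
  exact Filter.Eventually.of_forall hC

lemma ae_differentiableAt (hab : a ≤ b) (hf : InFormDomain a b V f) :
    ∀ᵐ x ∂volume.restrict (Icc a b), DifferentiableAt ℝ f x := by
  rw [ae_restrict_iff' measurableSet_Icc]
  simpa [uIcc_of_le hab] using hf.absCont.ae_differentiableAt

lemma integrable_mul (hab : a ≤ b) (hf : InFormDomain a b V f) (hg : InFormDomain a b V g) :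
    Integrable (fun x => f x * g x) (volume.restrict (Icc a b)) :=
  (hf.memLp_two hab).integrable_mul (hg.memLp_two hab)

lemma integrable_deriv_mul (hf : InFormDomain a b V f) (hg : InFormDomain a b V g) :
    Integrable (fun x => deriv f x * deriv g x) (volume.restrict (Icc a b)) :=
  hf.deriv_memLp.integrable_mul hg.deriv_memLp

lemma integrable_potential_mul (hab : a ≤ b) (hV : AEMeasurable V (volume.restrict (Icc a b)))
    (hf : InFormDomain a b V f) (hg : InFormDomain a b V g) :
    Integrable (fun x => V x * f x * g x) (volume.restrict (Icc a b)) := by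
  refine Integrable.mono' (g := fun x => |V x * f x ^ 2| + |V x * g x ^ 2|)
    (Integrable.add hf.potential.abs hg.potential.abs)
    ((hV.aestronglyMeasurable.mul (hf.memLp_two hab).1).mul (hg.memLp_two hab).1)
    (Filter.Eventually.of_forall fun x => ?_)
  simp only [Real.norm_eq_abs, abs_mul, abs_pow, sq_abs]
  have h := two_mul_le_add_sq |f x| |g x|
  have h0 : 0 ≤ |f x| * |g x| := by positivity
  rw [sq_abs, sq_abs] at h
  have := mul_le_mul_of_nonneg_left (show |f x| * |g x| ≤ f x ^ 2 + g x ^ 2 by nlinarith)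
    (abs_nonneg (V x))
  linarith

lemma integrable_energy (hab : a ≤ b) (hV : AEMeasurable V (volume.restrict (Icc a b)))
    (hf : InFormDomain a b V f) (hg : InFormDomain a b V g) :
    Integrable (fun x => deriv f x * deriv g x + V x * f x * g x)
      (volume.restrict (Icc a b)) :=
  (hf.integrable_deriv_mul hg).add (hf.integrable_potential_mul hab hV hg)

lemma deriv_comb_ae (hab : a ≤ b) (hf : InFormDomain a b V f) (hg : InFormDomain a b V g)
    (s t : ℝ) : deriv (fun x => s * f x + t * g x)
      =ᵐ[volume.restrict (Icc a b)] fun x => s * deriv f x + t * deriv g x := by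
  filter_upwards [hf.ae_differentiableAt hab, hg.ae_differentiableAt hab] with x hx hy
  exact ((hx.hasDerivAt.const_mul s).add (hy.hasDerivAt.const_mul t)).deriv

/-- The form domain is a linear subspace. -/
lemma comb (hab : a ≤ b) (hV : AEMeasurable V (volume.restrict (Icc a b)))
    (hf : InFormDomain a b V f) (hg : InFormDomain a b V g) (s t : ℝ) :
    InFormDomain a b V (fun x => s * f x + t * g x) where
  absCont := (hf.absCont.const_mul s).add (hg.absCont.const_mul t)
  left := by simp [hf.left, hg.left]
  right := by simp [hf.right, hg.right]
  deriv_memLp := ((hf.deriv_memLp.const_mul s).add (hg.deriv_memLp.const_mul t)).ae_eq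
    (hf.deriv_comb_ae hab hg s t).symm
  potential := by
    have h := ((hf.potential.const_mul (s ^ 2)).add
      ((hf.integrable_potential_mul hab hV hg).const_mul (2 * s * t))).add
      (hg.potential.const_mul (t ^ 2))
    refine h.congr (Filter.Eventually.of_forall fun x => ?_)
    simp only [Pi.add_apply]
    ring

lemma energy_comb (hab : a ≤ b) (hV : AEMeasurable V (volume.restrict (Icc a b)))
    (hf : InFormDomain a b V f) (hg : InFormDomain a b V g) (s t : ℝ) :
    energy a b V (fun x => s * f x + t * g x) (fun x => s * f x + t * g x)
      = s ^ 2 * energy a b V f f + 2 * s * t * energy a b V f g + t ^ 2 * energy a b V g g := by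
  rw [energy, energy, energy, energy,
    ← integral_comb_three (hf.integrable_energy hab hV hf) (hf.integrable_energy hab hV hg)
      (hg.integrable_energy hab hV hg)]
  refine integral_congr_ae ?_
  filter_upwards [hf.deriv_comb_ae hab hg s t] with x hx
  rw [hx]
  ring

lemma overlap_comb (hab : a ≤ b) (hf : InFormDomain a b V f) (hg : InFormDomain a b V g)
    (s t : ℝ) :
    overlap a b (fun x => s * f x + t * g x) (fun x => s * f x + t * g x)
      = s ^ 2 * overlap a b f f + 2 * s * t * overlap a b f g + t ^ 2 * overlap a b g g := by
  rw [overlap, overlap, overlap, overlap,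
    ← integral_comb_three (hf.integrable_mul hab hf) (hf.integrable_mul hab hg)
      (hg.integrable_mul hab hg)]
  congr 1
  ext x
  ring

lemma energy_self_eq (hf : InFormDomain a b V f) :
    energy a b V f f = (∫ x in Icc a b, deriv f x ^ 2) + ∫ x in Icc a b, V x * f x ^ 2 := by
  rw [energy, ← integral_add hf.deriv_memLp.integrable_sq hf.potential]
  congr 1
  ext x
  ring

/-- The kinetic term is controlled by the energy when `V` is bounded below by `m`. -/
lemma integral_deriv_sq_add_le_energy (hab : a ≤ b) {m : ℝ} (hm : ∀ x ∈ Icc a b, m ≤ V x)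
    (hf : InFormDomain a b V f) :
    (∫ x in Icc a b, deriv f x ^ 2) + m * overlap a b f f ≤ energy a b V f f := by
  rw [hf.energy_self_eq, overlap_self_eq, ← integral_const_mul]
  refine add_le_add le_rfl ?_
  refine setIntegral_mono_on ((hf.memLp_two hab).integrable_sq.const_mul m) hf.potential
    measurableSet_Icc fun x hx => ?_
  exact mul_le_mul_of_nonneg_right (hm x hx) (sq_nonneg _)

lemma overlap_self_pos (hab : a < b) (hf : InFormDomain a b V f) {x : ℝ} (hx : x ∈ Icc a b)
    (hfx : f x ≠ 0) : 0 < overlap a b f f := by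
  rw [overlap_self_eq, integral_Icc_eq_integral_Ioc, ← intervalIntegral.integral_of_le hab.le]
  exact intervalIntegral.integral_pos hab ((hf.continuousOn hab.le).pow 2)
    (fun y _ => sq_nonneg _) ⟨x, hx, by positivity⟩

/-! ### Pointwise bounds -/

/-- A function of the form domain satisfies `‖f‖_∞⁴ ≤ ‖f‖² ‖f'‖²`: at `x` the value `f x ^ 2` is
both `∫_a^x 2 f f'` and `-∫_x^b 2 f f'`, so that `f x ^ 2 ≤ ∫ |f f'|`. -/
lemma pow_four_le (hab : a ≤ b) (hf : InFormDomain a b V f) {x : ℝ} (hx : x ∈ Icc a b) :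
    f x ^ 4 ≤ overlap a b f f * ∫ y in Icc a b, deriv f y ^ 2 := by
  have hI : IntervalIntegrable (fun y => |f y * deriv f y|) volume a b := by
    rw [intervalIntegrable_iff_integrableOn_Icc_of_le hab]
    exact ((hf.memLp_two hab).integrable_mul hf.deriv_memLp).abs
  have h1 : ∀ c d : ℝ, c ∈ Icc a b → d ∈ Icc a b → c ≤ d →
      |f d ^ 2 - f c ^ 2| ≤ 2 * ∫ y in c..d, |f y * deriv f y| := by
    intro c d hc hd hcd
    have hac : AbsolutelyContinuousOnInterval f c d :=
      hf.absCont.mono (by rw [uIcc_of_le hab, uIcc_of_le hcd]; exact Icc_subset_Icc hc.1 hd.2)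
    have h := hac.integral_deriv_mul_eq_sub hac
    rw [sq, sq, ← h, ← intervalIntegral.integral_const_mul]
    refine (intervalIntegral.abs_integral_le_integral_abs hcd).trans (le_of_eq ?_)
    congr 1
    ext y
    rw [show deriv f y * f y + f y * deriv f y = 2 * (f y * deriv f y) by ring, abs_mul]
    simp
  have ha : a ∈ Icc a b := ⟨le_rfl, hab⟩
  have hb : b ∈ Icc a b := ⟨hab, le_rfl⟩
  have e1 := h1 a x ha hx hx.1
  have e2 := h1 x b hx hb hx.2
  have hadd : (∫ y in a..x, |f y * deriv f y|) + ∫ y in x..b, |f y * deriv f y|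
      = ∫ y in a..b, |f y * deriv f y| := by
    refine intervalIntegral.integral_add_adjacent_intervals (hI.mono_set ?_) (hI.mono_set ?_)
    · rw [uIcc_of_le hab, uIcc_of_le hx.1]; exact Icc_subset_Icc le_rfl hx.2
    · rw [uIcc_of_le hab, uIcc_of_le hx.2]; exact Icc_subset_Icc hx.1 le_rfl
  rw [hf.left] at e1
  rw [hf.right] at e2
  have e3 : f x ^ 2 ≤ ∫ y in Icc a b, |f y| * |deriv f y| := by
    have : ∫ y in Icc a b, |f y| * |deriv f y| = ∫ y in a..b, |f y * deriv f y| := by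
      rw [intervalIntegral.integral_of_le hab, integral_Icc_eq_integral_Ioc]
      simp only [abs_mul]
    rw [this, ← hadd]
    have := le_abs_self (f x ^ 2 - 0 ^ 2)
    have := neg_abs_le (0 ^ 2 - f x ^ 2)
    linarith
  have cs := sq_integral_mul_le (hf.memLp_two hab).abs hf.deriv_memLp.abs
  simp only [Pi.abs_apply, sq_abs] at cs
  rw [overlap_self_eq]
  calc f x ^ 4 = (f x ^ 2) ^ 2 := by ring
    _ ≤ (∫ y in Icc a b, |f y| * |deriv f y|) ^ 2 := by gcongr
    _ ≤ _ := cs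

/-- Functions with square-integrable derivative are Hölder continuous with exponent `1/2`. -/
lemma sq_sub_le (hab : a ≤ b) (hf : InFormDomain a b V f) {x y : ℝ} (hx : x ∈ Icc a b)
    (hy : y ∈ Icc a b) :
    (f x - f y) ^ 2 ≤ (∫ z in Icc a b, deriv f z ^ 2) * |x - y| := by
  wlog hxy : y ≤ x generalizing x y
  · rw [← neg_sub, neg_sq, abs_sub_comm]
    exact this hy hx (le_of_not_ge hxy)
  have hac : AbsolutelyContinuousOnInterval f y x :=
      hf.absCont.mono (by rw [uIcc_of_le hab, uIcc_of_le hxy]; exact Icc_subset_Icc hy.1 hx.2)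
  have hsub : Ioc y x ⊆ Icc a b := fun z hz => ⟨hy.1.trans hz.1.le, hz.2.trans hx.2⟩
  have h1 : MemLp (deriv f) 2 (volume.restrict (Ioc y x)) :=
    hf.deriv_memLp.mono_measure (Measure.restrict_mono hsub le_rfl)
  have cs := sq_integral_mul_le h1 (memLp_const (1 : ℝ))
  rw [← hac.integral_deriv_eq_sub, intervalIntegral.integral_of_le hxy]
  simp only [mul_one, one_pow, integral_const, MeasurableSet.univ, measureReal_restrict_apply,
    univ_inter, Real.volume_real_Ioc_of_le hxy, smul_eq_mul] at cs
  rw [abs_of_nonneg (sub_nonneg.2 hxy)]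
  refine cs.trans (mul_le_mul_of_nonneg_right ?_ (sub_nonneg.2 hxy))
  exact setIntegral_mono_set hf.deriv_memLp.integrable_sq
    (Filter.Eventually.of_forall fun z => sq_nonneg _) hsub.eventuallyLE

end InFormDomain

/-! ### Limits in `L²` and Fatou's lemma -/

lemma norm_toLp_two_sq {α : Type*} [MeasurableSpace α] {μ : Measure α} {u : α → ℝ}
    (hu : MemLp u 2 μ) : ‖hu.toLp u‖ ^ 2 = ∫ x, u x ^ 2 ∂μ := by
  rw [← real_inner_self_eq_norm_sq, L2.inner_def]
  refine integral_congr_ae ?_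
  filter_upwards [hu.coeFn_toLp] with x hx
  rw [hx]
  simp [sq]

/-- Completeness of `L²`, stated for functions and integrals of squares. -/
lemma exists_memLp_two_limit {α : Type*} [MeasurableSpace α] {μ : Measure α} {u : ℕ → α → ℝ}
    (hu : ∀ n, MemLp (u n) 2 μ)
    (hC : ∀ ε > 0, ∃ N, ∀ n ≥ N, ∀ k ≥ N, ∫ x, (u n x - u k x) ^ 2 ∂μ < ε) :
    ∃ U, MemLp U 2 μ ∧ Tendsto (fun n => ∫ x, (u n x - U x) ^ 2 ∂μ) atTop (𝓝 0) ∧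
      Tendsto (fun n => ∫ x, u n x ^ 2 ∂μ) atTop (𝓝 (∫ x, U x ^ 2 ∂μ)) := by
  have hcs : CauchySeq fun n => (hu n).toLp (u n) := by
    rw [Metric.cauchySeq_iff]
    intro ε hε
    obtain ⟨N, hN⟩ := hC (ε ^ 2) (by positivity)
    refine ⟨N, fun n hn k hk => ?_⟩
    have h := hN n hn k hk
    rw [dist_eq_norm, ← MemLp.toLp_sub]
    refine lt_of_pow_lt_pow_left₀ 2 hε.le ?_
    rw [norm_toLp_two_sq]
    simpa using h
  obtain ⟨L, hL⟩ := cauchySeq_tendsto_of_complete hcs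
  have hLm : MemLp L 2 μ := Lp.memLp L
  have hLL : hLm.toLp L = L := Lp.toLp_coeFn L hLm
  refine ⟨L, hLm, ?_, ?_⟩
  · have h := ((tendsto_iff_norm_sub_tendsto_zero.1 hL).pow 2)
    rw [zero_pow two_ne_zero] at h
    refine h.congr fun n => ?_
    have e : (hu n).toLp (u n) - L = ((hu n).sub hLm).toLp (u n - (L : α → ℝ)) := by
      rw [MemLp.toLp_sub (hu n) hLm, hLL]
    rw [e, norm_toLp_two_sq]
    simp
  · have h := hL.norm.pow 2
    simp only [norm_toLp_two_sq] at h
    rwa [← hLL, norm_toLp_two_sq] at h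

/-- **Fatou's lemma** for real integrals. -/
lemma integrable_and_integral_le_of_tendsto {α : Type*} [MeasurableSpace α] {μ : Measure α}
    {h : ℕ → α → ℝ} {H : α → ℝ} {c : ℝ} (hi : ∀ n, Integrable (h n) μ)
    (h0 : ∀ n, 0 ≤ᵐ[μ] h n) (hH : ∀ᵐ x ∂μ, Tendsto (fun n => h n x) atTop (𝓝 (H x)))
    (hc : Tendsto (fun n => ∫ x, h n x ∂μ) atTop (𝓝 c)) :
    Integrable H μ ∧ ∫ x, H x ∂μ ≤ c := by
  have hHm : AEStronglyMeasurable H μ :=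
    aestronglyMeasurable_of_tendsto_ae atTop (fun n => (hi n).1) hH
  have hH0 : 0 ≤ᵐ[μ] H := by
    filter_upwards [hH, ae_all_iff.2 h0] with x hx h0x
    exact ge_of_tendsto' hx h0x
  have hc0 : 0 ≤ c := ge_of_tendsto' hc fun n => integral_nonneg_of_ae (h0 n)
  have hle : ∫⁻ x, ENNReal.ofReal (H x) ∂μ ≤ ENNReal.ofReal c := by
    calc ∫⁻ x, ENNReal.ofReal (H x) ∂μ
        = ∫⁻ x, liminf (fun n => ENNReal.ofReal (h n x)) atTop ∂μ := by
          refine lintegral_congr_ae ?_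
          filter_upwards [hH] with x hx
          exact ((ENNReal.continuous_ofReal.tendsto _).comp hx).liminf_eq.symm
      _ ≤ liminf (fun n => ∫⁻ x, ENNReal.ofReal (h n x) ∂μ) atTop :=
          lintegral_liminf_le' fun n => (hi n).1.aemeasurable.ennreal_ofReal
      _ = liminf (fun n => ENNReal.ofReal (∫ x, h n x ∂μ)) atTop := by
          simp only [ofReal_integral_eq_lintegral_ofReal (hi _) (h0 _)]
      _ = ENNReal.ofReal c := ((ENNReal.continuous_ofReal.tendsto _).comp hc).liminf_eq
  refine ⟨⟨hHm, ?_⟩, ?_⟩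
  · rw [hasFiniteIntegral_iff_ofReal hH0]
    exact hle.trans_lt ENNReal.ofReal_lt_top
  · rw [integral_eq_lintegral_of_nonneg_ae hH0 hHm]
    exact ENNReal.toReal_le_of_le_ofReal hc0 hle

/-! ### Compactness and closedness of the form -/
/-- **Arzelà–Ascoli** for a sequence of uniformly Hölder continuous functions vanishing at `a`. -/
lemma exists_subseq_tendstoUniformlyOn (hab : a ≤ b) {f : ℕ → ℝ → ℝ} {K : ℝ}
    (hfa : ∀ n, f n a = 0)
    (hK : ∀ n, ∀ x ∈ Icc a b, ∀ y ∈ Icc a b, (f n x - f n y) ^ 2 ≤ K * |x - y|) :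
    ∃ φ : ℕ → ℕ, StrictMono φ ∧ ∃ F : ℝ → ℝ,
      TendstoUniformlyOn (fun n => f (φ n)) F atTop (Icc a b) := by
  have hmod : ∀ (x y : Icc a b) (n : ℕ),
      dist (f n x) (f n y) ≤ Real.sqrt (K * dist x y) := by
    intro x y n
    rw [Real.dist_eq, Subtype.dist_eq, Real.dist_eq]
    exact Real.abs_le_sqrt (hK n x x.2 y y.2)
  have hlim : Tendsto (fun t : ℝ => Real.sqrt (K * t)) (𝓝 0) (𝓝 0) := by
    have : Continuous fun t : ℝ => Real.sqrt (K * t) := by fun_prop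
    simpa using this.tendsto 0
  have heq : Equicontinuous fun (n : ℕ) (x : Icc a b) => f n x :=
    Metric.equicontinuous_of_continuity_modulus _ hlim _ hmod
  let G : ℕ → BoundedContinuousFunction (Icc a b) ℝ := fun n =>
    BoundedContinuousFunction.mkOfCompact ⟨fun x => f n x, heq.continuous n⟩
  have hGcpt : IsCompact (closure (range G)) := by
    refine BoundedContinuousFunction.arzela_ascoli
      (Metric.closedBall 0 (Real.sqrt (K * (b - a)))) (isCompact_closedBall _ _) _ ?_ ?_
    · rintro _ x ⟨n, rfl⟩
      rw [mem_closedBall_zero_iff, Real.norm_eq_abs]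
      refine Real.abs_le_sqrt ?_
      have h := hK n x x.2 a ⟨le_rfl, hab⟩
      have hK0 : 0 ≤ K * |b - a| := (sq_nonneg _).trans (hK n b ⟨hab, le_rfl⟩ a ⟨le_rfl, hab⟩)
      rw [hfa, sub_zero, abs_of_nonneg (sub_nonneg.2 x.2.1)] at h
      rw [abs_of_nonneg (sub_nonneg.2 hab)] at hK0
      refine h.trans ?_
      rcases hab.eq_or_lt with rfl | hlt
      · have : (x : ℝ) = a := le_antisymm x.2.2 x.2.1
        simp [this]
      · have : 0 ≤ K := nonneg_of_mul_nonneg_left hK0 (sub_pos.2 hlt)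
        exact mul_le_mul_of_nonneg_left (sub_le_sub_right x.2.2 a) this
    · intro x U hU
      filter_upwards [heq x U hU] with y hy
      rintro ⟨_, n, rfl⟩
      exact hy n
  obtain ⟨L, -, φ, hφ, hL⟩ :=
    hGcpt.tendsto_subseq (x := G) fun n => subset_closure (mem_range_self n)
  refine ⟨φ, hφ, IccExtend hab L, ?_⟩
  rw [tendstoUniformlyOn_iff_tendstoUniformly_comp_coe]
  rw [BoundedContinuousFunction.tendsto_iff_tendstoUniformly] at hL
  convert! hL using 1
  ext x
  simp

/-- An `L²` function is the derivative of its primitive, which is absolutely continuous. -/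
lemma primitive_properties (hab : a ≤ b) {u : ℝ → ℝ}
    (hu : MemLp u 2 (volume.restrict (Icc a b))) :
    AbsolutelyContinuousOnInterval (fun x => ∫ t in a..x, u t) a b ∧
      deriv (fun x => ∫ t in a..x, u t) =ᵐ[volume.restrict (Icc a b)] u := by
  have hI : IntervalIntegrable u volume a b := by
    rw [intervalIntegrable_iff_integrableOn_Icc_of_le hab]
    exact hu.integrable (by norm_num)
  refine ⟨hI.absolutelyContinuousOnInterval_intervalIntegral left_mem_uIcc, ?_⟩
  rw [EventuallyEq, ae_restrict_iff' measurableSet_Icc]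
  filter_upwards [hI.ae_hasDerivAt_integral] with x hx hxI
  rw [← uIcc_of_le hab] at hxI
  exact (hx hxI a left_mem_uIcc).deriv

/-- The form is closed: a sequence in the form domain whose derivatives are Cauchy in `L²` and
whose energies converge has a limit in the form domain, and the energy is lower semicontinuous. -/
lemma exists_formDomain_limit (hab : a ≤ b) {m : ℝ} (hm : ∀ x ∈ Icc a b, m ≤ V x)
    {f : ℕ → ℝ → ℝ} (hf : ∀ n, InFormDomain a b V (f n))
    (hC : ∀ ε > 0, ∃ N, ∀ n ≥ N, ∀ k ≥ N,
      ∫ x in Icc a b, (deriv (f n) x - deriv (f k) x) ^ 2 < ε)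
    {r s : ℝ} (hr : Tendsto (fun n => energy a b V (f n) (f n)) atTop (𝓝 r))
    (hs : ∀ n, overlap a b (f n) (f n) = s) :
    ∃ F, InFormDomain a b V F ∧ overlap a b F F = s ∧ energy a b V F F ≤ r := by
  obtain ⟨u, hu, hu0, hu2⟩ := exists_memLp_two_limit (fun n => (hf n).deriv_memLp) hC
  obtain ⟨hFac, hFd⟩ := primitive_properties hab hu
  set F : ℝ → ℝ := fun x => ∫ t in a..x, u t with hF
  have hpt : ∀ x ∈ Icc a b, Tendsto (fun n => f n x) atTop (𝓝 (F x)) := by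
    intro x hx
    have hsub : Ioc a x ⊆ Icc a b := fun z hz => ⟨hz.1.le, hz.2.trans hx.2⟩
    have hle : ∀ n, (f n x - F x) ^ 2
        ≤ (∫ y in Icc a b, (deriv (f n) y - u y) ^ 2) * (x - a) := by
      intro n
      have hac : AbsolutelyContinuousOnInterval (f n) a x := (hf n).absCont.mono (by
        rw [uIcc_of_le hab, uIcc_of_le hx.1]; exact Icc_subset_Icc le_rfl hx.2)
      have hd : MemLp (fun y => deriv (f n) y - u y) 2 (volume.restrict (Icc a b)) :=
        (hf n).deriv_memLp.sub hu
      have h1 := (hf n).deriv_memLp.mono_measure (Measure.restrict_mono hsub le_rfl)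
      have h2 := hu.mono_measure (Measure.restrict_mono hsub le_rfl)
      have cs := sq_integral_mul_le (h1.sub h2) (memLp_const (1 : ℝ))
      have e : f n x - F x = ∫ y in Ioc a x, (deriv (f n) y - u y) := by
        rw [integral_sub (h1.integrable (by norm_num)) (h2.integrable (by norm_num)),
          ← intervalIntegral.integral_of_le hx.1, ← intervalIntegral.integral_of_le hx.1,
          hac.integral_deriv_eq_sub, (hf n).left, sub_zero]
      simp only [Pi.sub_apply, mul_one, one_pow, integral_const, MeasurableSet.univ,
        measureReal_restrict_apply, univ_inter, Real.volume_real_Ioc_of_le hx.1,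
        smul_eq_mul] at cs
      rw [e]
      refine cs.trans (mul_le_mul_of_nonneg_right ?_ (sub_nonneg.2 hx.1))
      exact setIntegral_mono_set hd.integrable_sq
        (Eventually.of_forall fun z => sq_nonneg _) hsub.eventuallyLE
    have h0 : Tendsto (fun n => (f n x - F x) ^ 2) atTop (𝓝 0) := by
      refine squeeze_zero (fun n => sq_nonneg _) hle ?_
      simpa using hu0.mul_const (x - a)
    have h1 := h0.sqrt
    simp only [Real.sqrt_sq_eq_abs, Real.sqrt_zero] at h1
    exact tendsto_sub_nhds_zero_iff.1 (tendsto_zero_iff_abs_tendsto_zero _ |>.2 h1)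
  have hptae : ∀ᵐ x ∂volume.restrict (Icc a b), Tendsto (fun n => f n x) atTop (𝓝 (F x)) := by
    rw [ae_restrict_iff' measurableSet_Icc]
    exact Eventually.of_forall hpt
  have hVae : ∀ᵐ x ∂volume.restrict (Icc a b), m ≤ V x := by
    rw [ae_restrict_iff' measurableSet_Icc]
    exact Eventually.of_forall hm
  have hFderiv : MemLp (deriv F) 2 (volume.restrict (Icc a b)) := hu.ae_eq hFd.symm
  have hFc : ContinuousOn F (Icc a b) := by simpa [uIcc_of_le hab] using hFac.continuousOn
  -- the overlaps converge by domination: the functions are uniformly bounded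
  have hFs : ∫ x in Icc a b, F x ^ 2 = s := by
    obtain ⟨K, hK⟩ := hu2.bddAbove_range
    have hlim : Tendsto (fun n => ∫ x in Icc a b, f n x ^ 2) atTop
        (𝓝 (∫ x in Icc a b, F x ^ 2)) := by
      refine tendsto_integral_of_dominated_convergence (fun _ => K * (b - a))
        (fun n => ((hf n).memLp_two hab).integrable_sq.1) (integrable_const _) (fun n => ?_) ?_
      · rw [ae_restrict_iff' measurableSet_Icc]
        refine Eventually.of_forall fun x hx => ?_
        have h := (hf n).sq_sub_le hab hx ⟨le_rfl, hab⟩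
        rw [(hf n).left, sub_zero, abs_of_nonneg (sub_nonneg.2 hx.1)] at h
        rw [Real.norm_of_nonneg (sq_nonneg _)]
        have hKn : ∫ x in Icc a b, deriv (f n) x ^ 2 ≤ K := hK (mem_range_self n)
        have h0 : 0 ≤ ∫ x in Icc a b, deriv (f n) x ^ 2 := integral_nonneg fun _ => sq_nonneg _
        exact h.trans (mul_le_mul hKn (by linarith [hx.2]) (by linarith [hx.1]) (h0.trans hKn))
      · filter_upwards [hptae] with x hx using hx.pow 2
    refine tendsto_nhds_unique hlim ?_
    simp only [← overlap_self_eq, hs]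
    exact tendsto_const_nhds
  have hFi : Integrable (fun x => F x ^ 2) (volume.restrict (Icc a b)) :=
    (hFc.pow 2).integrableOn_Icc
  have e : ∀ n, ∫ x in Icc a b, (V x - m) * f n x ^ 2
      = energy a b V (f n) (f n) - (∫ x in Icc a b, deriv (f n) x ^ 2) - m * s := by
    intro n
    have h2 : ∫ x in Icc a b, f n x ^ 2 = s := by rw [← overlap_self_eq, hs]
    simp only [sub_mul]
    rw [integral_sub (hf n).potential (((hf n).memLp_two hab).integrable_sq.const_mul m),
      (hf n).energy_self_eq, integral_const_mul, h2]
    ring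
  obtain ⟨hi, hle⟩ := integrable_and_integral_le_of_tendsto
    (μ := volume.restrict (Icc a b)) (h := fun n x => (V x - m) * f n x ^ 2)
    (H := fun x => (V x - m) * F x ^ 2)
    (c := r - (∫ x in Icc a b, u x ^ 2) - m * s)
    (fun n => by
      simp only [sub_mul]
      exact (hf n).potential.sub (((hf n).memLp_two hab).integrable_sq.const_mul m))
    (fun n => by
      filter_upwards [hVae] with x hx using mul_nonneg (sub_nonneg.2 hx) (sq_nonneg _))
    (by filter_upwards [hptae] with x hx using (hx.pow 2).const_mul _)
    (by simp only [e]; exact (hr.sub hu2).sub_const _)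
  have hFpot : IntegrableOn (fun x => V x * F x ^ 2) (Icc a b) := by
    refine (hi.add (hFi.const_mul m)).congr (Eventually.of_forall fun x => ?_)
    simp only [Pi.add_apply]
    ring
  have hFb : F b = 0 := by
    refine tendsto_nhds_unique (hpt b ⟨hab, le_rfl⟩) ?_
    simp only [(hf _).right]
    exact tendsto_const_nhds
  have hFD : InFormDomain a b V F :=
    ⟨hFac, by simp [hF], hFb, hFderiv, hFpot⟩
  refine ⟨F, hFD, by rw [overlap_self_eq, hFs], ?_⟩
  have e1 : ∫ x in Icc a b, deriv F x ^ 2 = ∫ x in Icc a b, u x ^ 2 := by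
    refine integral_congr_ae ?_
    filter_upwards [hFd] with x hx
    rw [hx]
  simp only [sub_mul] at hle
  rw [integral_sub hFpot (hFi.const_mul m), integral_const_mul, hFs] at hle
  rw [hFD.energy_self_eq, e1]
  linarith

/-! ### Existence of the ground state -/

/-- Homogeneity and, for functions of zero norm, the lower bound on `V` extend a bound on the
energy from normalized functions to the whole form domain. -/
lemma InFormDomain.mul_overlap_le_energy (hab : a < b)
    (hV : AEMeasurable V (volume.restrict (Icc a b))) {m : ℝ} (hm : ∀ x ∈ Icc a b, m ≤ V x)
    {r : ℝ} (hr : ∀ f, InFormDomain a b V f → overlap a b f f = 1 → r ≤ energy a b V f f)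
    (hg : InFormDomain a b V g) : r * overlap a b g g ≤ energy a b V g g := by
  rcases (overlap_self_nonneg : 0 ≤ overlap a b g g).eq_or_lt with h0 | h0
  · have h := hg.integral_deriv_sq_add_le_energy hab.le hm
    rw [← h0, mul_zero, add_zero] at h
    rw [← h0, mul_zero]
    exact (integral_nonneg fun x => sq_nonneg _).trans h
  · set c := Real.sqrt (overlap a b g g)
    have hcc : c ^ 2 = overlap a b g g := Real.sq_sqrt h0.le
    have hc0 : 0 < c := Real.sqrt_pos.2 h0
    have h1 := hg.overlap_comb hab.le hg c⁻¹ 0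
    have h2 := hg.energy_comb hab.le hV hg c⁻¹ 0
    have h3 := hr _ (hg.comb hab.le hV hg c⁻¹ 0) (by
      rw [h1, ← hcc]; field_simp; ring)
    rw [h2] at h3
    have h4 : r ≤ (c ^ 2)⁻¹ * energy a b V g g := by
      rw [← inv_pow]; linarith
    rw [← hcc]
    rwa [inv_mul_eq_div, le_div_iff₀ (by positivity)] at h4

lemma InFormDomain.exists_normalized (hab : a ≤ b)
    (hV : AEMeasurable V (volume.restrict (Icc a b))) (hg : InFormDomain a b V g)
    (h0 : 0 < overlap a b g g) : ∃ f, InFormDomain a b V f ∧ overlap a b f f = 1 := by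
  set c := Real.sqrt (overlap a b g g)
  have hcc : c ^ 2 = overlap a b g g := Real.sq_sqrt h0.le
  have hc0 : 0 < c := Real.sqrt_pos.2 h0
  refine ⟨_, hg.comb hab hV hg c⁻¹ 0, ?_⟩
  rw [hg.overlap_comb hab hg, ← hcc]
  field_simp
  ring

/-- **Existence of a ground state.** By Arzelà–Ascoli a minimizing sequence has a uniformly
convergent subsequence. By the parallelogram law that subsequence is Cauchy for the energy as well,
since the midpoint of two almost minimizers that are close in `L²` has at least about the minimal
energy. -/
theorem exists_minimizer (hab : a < b) (hV : AEMeasurable V (volume.restrict (Icc a b))) {m : ℝ}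
    (hm : ∀ x ∈ Icc a b, m ≤ V x) (hg : InFormDomain a b V g) (hg0 : 0 < overlap a b g g) :
    ∃ F, InFormDomain a b V F ∧ overlap a b F F = 1 ∧
      ∀ h, InFormDomain a b V h → energy a b V F F * overlap a b h h ≤ energy a b V h h := by
  set S : Set ℝ := {e | ∃ f, InFormDomain a b V f ∧ overlap a b f f = 1 ∧ energy a b V f f = e}
  have hSne : S.Nonempty := by
    obtain ⟨f, hf, hf1⟩ := hg.exists_normalized hab.le hV hg0
    exact ⟨_, f, hf, hf1, rfl⟩
  have hSbdd : BddBelow S := by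
    refine ⟨m, ?_⟩
    rintro _ ⟨f, hf, hf1, rfl⟩
    have h := hf.integral_deriv_sq_add_le_energy hab.le hm
    rw [hf1, mul_one] at h
    have : 0 ≤ ∫ x in Icc a b, deriv f x ^ 2 := integral_nonneg fun _ => sq_nonneg _
    linarith
  set r := sInf S
  have hray : ∀ h, InFormDomain a b V h → r * overlap a b h h ≤ energy a b V h h := fun h hh =>
    hh.mul_overlap_le_energy hab hV hm fun f hf hf1 => csInf_le hSbdd ⟨f, hf, hf1, rfl⟩
  obtain ⟨e, -, he, heS⟩ := exists_seq_tendsto_sInf hSne hSbdd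
  choose f0 hf0 hf01 hf0e using heS
  obtain ⟨K, hK⟩ := he.bddAbove_range
  obtain ⟨φ, hφ, G, hG⟩ := exists_subseq_tendstoUniformlyOn hab.le (f := f0) (K := K - m)
    (fun n => (hf0 n).left) (fun n x hx y hy => by
      refine ((hf0 n).sq_sub_le hab.le hx hy).trans
        (mul_le_mul_of_nonneg_right ?_ (abs_nonneg _))
      have h := (hf0 n).integral_deriv_sq_add_le_energy hab.le hm
      rw [hf01, mul_one, hf0e] at h
      have : e n ≤ K := hK (mem_range_self n)
      linarith)
  set f : ℕ → ℝ → ℝ := fun n => f0 (φ n) with hf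
  have hfD : ∀ n, InFormDomain a b V (f n) := fun n => hf0 _
  have hf1 : ∀ n, overlap a b (f n) (f n) = 1 := fun n => hf01 _
  have hfe : Tendsto (fun n => energy a b V (f n) (f n)) atTop (𝓝 r) := by
    simp only [hf, hf0e]
    exact he.comp hφ.tendsto_atTop
  -- the differences are small in the energy norm
  have hdiff : ∀ n k, ∫ x in Icc a b, (deriv (f n) x - deriv (f k) x) ^ 2
      ≤ 2 * (energy a b V (f n) (f n) - r) + 2 * (energy a b V (f k) (f k) - r)
        + (r - m) * ∫ x in Icc a b, (f n x - f k x) ^ 2 := by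
    intro n k
    have hsub := (hfD n).comb hab.le hV (hfD k) 1 (-1)
    have hadd := (hfD n).comb hab.le hV (hfD k) 1 1
    have h1 := hsub.integral_deriv_sq_add_le_energy hab.le hm
    have h2 := hray _ hadd
    rw [(hfD n).energy_comb hab.le hV (hfD k), (hfD n).overlap_comb hab.le (hfD k), hf1, hf1] at h2
    rw [(hfD n).energy_comb hab.le hV (hfD k)] at h1
    have h3 := (hfD n).overlap_comb hab.le (hfD k) 1 (-1)
    rw [hf1, hf1] at h3
    have e1 : ∫ x in Icc a b, (f n x - f k x) ^ 2
        = overlap a b (fun x => 1 * f n x + -1 * f k x) (fun x => 1 * f n x + -1 * f k x) := by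
      rw [overlap_self_eq]
      congr 1
      ext x
      ring
    have e2 : ∫ x in Icc a b, (deriv (f n) x - deriv (f k) x) ^ 2
        = ∫ x in Icc a b, deriv (fun x => 1 * f n x + -1 * f k x) x ^ 2 := by
      refine integral_congr_ae ?_
      filter_upwards [(hfD n).deriv_comb_ae hab.le (hfD k) 1 (-1)] with x hx
      rw [hx]
      ring
    rw [e2, e1]
    rw [h3] at h1 ⊢
    linarith
  have hcauchy : ∀ ε > 0, ∃ N, ∀ n ≥ N, ∀ k ≥ N,
      ∫ x in Icc a b, (deriv (f n) x - deriv (f k) x) ^ 2 < ε := by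
    intro ε hε
    -- half of `ε` is spent on the `L²` distance, half on the two energy excesses of `ε / 8` each
    obtain ⟨δ, hδ0, hδ⟩ : ∃ δ > 0, (|r - m| * (b - a)) * δ ^ 2 < ε / 2 := by
      have ht : Tendsto (fun δ : ℝ => (|r - m| * (b - a)) * δ ^ 2) (𝓝[>] 0) (𝓝 0) := by
        have : Continuous fun δ : ℝ => (|r - m| * (b - a)) * δ ^ 2 := by fun_prop
        have h := this.tendsto 0
        rw [zero_pow two_ne_zero, mul_zero] at h
        exact h.mono_left nhdsWithin_le_nhds
      exact (eventually_mem_nhdsWithin.and (ht.eventually_lt_const (half_pos hε))).exists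
    have hu := Metric.tendstoUniformlyOn_iff.1 hG (δ / 2) (half_pos hδ0)
    have hev := hfe.eventually_lt_const (show r < r + ε / 8 by linarith)
    obtain ⟨N, hN⟩ := eventually_atTop.1 (hu.and hev)
    refine ⟨N, fun n hn k hk => (hdiff n k).trans_lt ?_⟩
    have hsq : ∫ x in Icc a b, (f n x - f k x) ^ 2 ≤ δ ^ 2 * (b - a) := by
      have hcn := ((hfD n).continuousOn hab.le).sub ((hfD k).continuousOn hab.le)
      have h := setIntegral_mono_on (μ := volume) (s := Icc a b)
        (f := fun x => (f n x - f k x) ^ 2) (g := fun _ => δ ^ 2)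
        (hcn.pow 2).integrableOn_Icc (integrable_const _) measurableSet_Icc (fun x hx => by
          have d1 := (hN n hn).1 x hx
          have d2 := (hN k hk).1 x hx
          have d3 : dist (f n x) (f k x) < δ := by
            have := dist_triangle_left (f n x) (f k x) (G x)
            linarith
          rw [Real.dist_eq] at d3
          rw [← sq_abs]
          gcongr)
      refine h.trans (le_of_eq ?_)
      simp [Real.volume_real_Icc_of_le hab.le, mul_comm]
    have hI0 : 0 ≤ ∫ x in Icc a b, (f n x - f k x) ^ 2 := integral_nonneg fun _ => sq_nonneg _
    have h4 : (r - m) * ∫ x in Icc a b, (f n x - f k x) ^ 2 ≤ |r - m| * (δ ^ 2 * (b - a)) :=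
      mul_le_mul (le_abs_self _) hsq hI0 (abs_nonneg _)
    have h5 := (hN n hn).2
    have h6 := (hN k hk).2
    linarith
  obtain ⟨F, hF, hF1, hFr⟩ := exists_formDomain_limit hab.le hm hfD hcauchy hfe hf1
  refine ⟨F, hF, hF1, fun h hh => ?_⟩
  exact (mul_le_mul_of_nonneg_right hFr overlap_self_nonneg).trans (hray h hh)

/-- A minimizer of the Rayleigh quotient is an eigenfunction: the nonnegative quadratic form
`energy - μ * overlap` vanishes at the minimizer, hence so does its first variation there. -/
lemma isEigenfunction_of_minimizer (hab : a < b)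
    (hV : AEMeasurable V (volume.restrict (Icc a b))) (hf : InFormDomain a b V f)
    (hf1 : overlap a b f f = 1)
    (hmin : ∀ h, InFormDomain a b V h →
      energy a b V f f * overlap a b h h ≤ energy a b V h h) :
    IsEigenfunction a b V (energy a b V f f) f := by
  refine ⟨hf, ?_, fun g hg => ?_⟩
  · by_contra! h
    have : overlap a b f f = 0 := by
      rw [overlap]
      exact setIntegral_eq_zero_of_forall_eq_zero fun x hx => by simp [h x hx]
    rw [hf1] at this
    exact one_ne_zero this
  · change energy a b V f g = energy a b V f f * overlap a b f g
    set A := energy a b V f g - energy a b V f f * overlap a b f g with hA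
    have key : ∀ t : ℝ, 0 ≤ (energy a b V g g - energy a b V f f * overlap a b g g) * (t * t)
        + (2 * A) * t + 0 := by
      intro t
      have h := hmin _ (hf.comb hab.le hV hg 1 t)
      rw [hf.energy_comb hab.le hV hg, hf.overlap_comb hab.le hg, hf1] at h
      rw [hA]
      linarith
    have hd := discrim_le_zero key
    rw [discrim] at hd
    have : A ^ 2 ≤ 0 := by linarith
    have hA0 : A = 0 := by simpa using le_antisymm this (sq_nonneg A)
    exact sub_eq_zero.1 hA0

/-- Testing the eigenvalue equation with the eigenfunction itself. -/
lemma IsEigenfunction.energy_self {μ : ℝ} (hf : IsEigenfunction a b V μ f) :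
    energy a b V f f = μ * overlap a b f f :=
  hf.2.2 f hf.1

lemma IsEigenfunction.overlap_self_pos {μ : ℝ} (hab : a < b) (hf : IsEigenfunction a b V μ f) :
    0 < overlap a b f f := by
  obtain ⟨x, hx, hfx⟩ := hf.2.1
  exact hf.1.overlap_self_pos hab hx hfx

/-- The **variational principle**: the least Rayleigh quotient is the least eigenvalue. -/
theorem exists_isLeast_eigenvalues (hab : a < b)
    (hV : AEMeasurable V (volume.restrict (Icc a b))) {m : ℝ} (hm : ∀ x ∈ Icc a b, m ≤ V x)
    (hg : InFormDomain a b V g) (hg0 : 0 < overlap a b g g) :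
    ∃ lam, IsLeast (eigenvalues a b V) lam ∧
      ∀ h, InFormDomain a b V h → lam * overlap a b h h ≤ energy a b V h h := by
  obtain ⟨F, hF, hF1, hmin⟩ := exists_minimizer hab hV hm hg hg0
  refine ⟨_, ⟨⟨F, isEigenfunction_of_minimizer hab hV hF hF1 hmin⟩, ?_⟩, hmin⟩
  rintro μ ⟨f, hf⟩
  have h := hmin f hf.1
  rw [hf.energy_self] at h
  exact le_of_mul_le_mul_right h (hf.overlap_self_pos hab)

/-! ### The lower bound -/

lemma nullMeasurableSet_sublevel (hV : AEMeasurable V (volume.restrict (Icc a b))) (y : ℝ) :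
    NullMeasurableSet (sublevel a b V y) (volume.restrict (Icc a b)) := by
  have h : NullMeasurableSet {x | V x ≤ y} (volume.restrict (Icc a b)) :=
    nullMeasurableSet_le hV aemeasurable_const
  exact measurableSet_Icc.nullMeasurableSet.inter h

lemma integral_indicator_sublevel (hV : AEMeasurable V (volume.restrict (Icc a b))) (y C : ℝ) :
    ∫ x in Icc a b, (sublevel a b V y).indicator (fun _ => C) x = width a b V y * C := by
  rw [integral_indicator₀ (nullMeasurableSet_sublevel hV y), setIntegral_const, measureReal_def,
    Measure.restrict_apply' measurableSet_Icc,
    inter_eq_self_of_subset_left fun x hx => hx.1, smul_eq_mul, width]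

lemma bddBelow_widthValues : BddBelow (widthValues a b V) := by
  refine ⟨infV a b V, ?_⟩
  rintro _ ⟨y, hy, hw, rfl⟩
  have : 0 < 1 / width a b V y ^ 2 := by positivity
  linarith

lemma IsEigenfunction.integral_deriv_sq_pos {μ : ℝ} (hab : a ≤ b)
    (hf : IsEigenfunction a b V μ f) : 0 < ∫ x in Icc a b, deriv f x ^ 2 := by
  obtain ⟨x, hx, hfx⟩ := hf.2.1
  have h := hf.1.pow_four_le hab hx
  have h4 : 0 < f x ^ 4 := by positivity
  exact pos_of_mul_pos_right (h4.trans_le h) overlap_self_nonneg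

lemma infV_lt_of_mem_eigenvalues (hab : a < b) (hVb : BddBelow (V '' Icc a b)) {μ : ℝ}
    (hμ : μ ∈ eigenvalues a b V) : infV a b V < μ := by
  obtain ⟨f, hf⟩ := hμ
  have h := hf.1.integral_deriv_sq_add_le_energy (m := infV a b V) hab.le
    fun x hx => csInf_le hVb (mem_image_of_mem V hx)
  rw [hf.energy_self] at h
  have hD := hf.integral_deriv_sq_pos hab.le
  exact lt_of_mul_lt_mul_right (by linarith) (hf.overlap_self_pos hab).le

/-- A lower bound for every eigenvalue, with constant `1 / 6`. By Markov's inequality at least half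
of the mass of an eigenfunction lies where `V - inf V ≤ 2 (μ - inf V)`; since the eigenfunction is
bounded by `(μ - inf V) ^ (1 / 4)` times its norm, this set cannot be short. -/
theorem widthMin_sub_infV_le (hab : a < b) (hV : AEMeasurable V (volume.restrict (Icc a b)))
    (hVb : BddBelow (V '' Icc a b)) {μ : ℝ} (hμ : μ ∈ eigenvalues a b V) :
    widthMin a b V - infV a b V ≤ 6 * (μ - infV a b V) := by
  have hl : 0 < μ - infV a b V := sub_pos.2 (infV_lt_of_mem_eigenvalues hab hVb hμ)
  obtain ⟨f, hf⟩ := hμ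
  set m := infV a b V
  have hm : ∀ x ∈ Icc a b, m ≤ V x := fun x hx => csInf_le hVb (mem_image_of_mem V hx)
  set N := overlap a b f f
  set D := ∫ x in Icc a b, deriv f x ^ 2
  have hN0 : 0 < N := hf.overlap_self_pos hab
  have hD0 : 0 < D := hf.integral_deriv_sq_pos hab.le
  have hfi : Integrable (fun x => f x ^ 2) (volume.restrict (Icc a b)) :=
    (hf.1.memLp_two hab.le).integrable_sq
  have hWi : Integrable (fun x => (V x - m) * f x ^ 2) (volume.restrict (Icc a b)) := by
    simp only [sub_mul]
    exact hf.1.potential.sub (hfi.const_mul m)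
  have hen : D + ∫ x in Icc a b, (V x - m) * f x ^ 2 = (μ - m) * N := by
    have h := hf.energy_self
    rw [hf.1.energy_self_eq] at h
    simp only [sub_mul]
    rw [integral_sub hf.1.potential (hfi.const_mul m), integral_const_mul, ← overlap_self_eq]
    linarith
  set l := μ - m
  set w := width a b V (m + 2 * l) with hw
  have hw0 : 0 ≤ w := ENNReal.toReal_nonneg
  have hmass : N ≤ w * Real.sqrt (N * D) + (2 * l)⁻¹ * ∫ x in Icc a b, (V x - m) * f x ^ 2 := by
    have hind : Integrable ((sublevel a b V (m + 2 * l)).indicator fun _ => Real.sqrt (N * D))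
        (volume.restrict (Icc a b)) :=
      (integrable_const _).indicator₀ (nullMeasurableSet_sublevel hV _)
    rw [hw, ← integral_indicator_sublevel hV, ← integral_const_mul (2 * l)⁻¹,
      ← integral_add hind (hWi.const_mul _)]
    refine overlap_self_eq.trans_le ?_
    refine setIntegral_mono_on hfi (hind.add (hWi.const_mul _)) measurableSet_Icc fun x hx => ?_
    have hWx : 0 ≤ V x - m := sub_nonneg.2 (hm x hx)
    by_cases hxy : x ∈ sublevel a b V (m + 2 * l)
    · rw [indicator_of_mem hxy]
      have h1 : f x ^ 2 ≤ Real.sqrt (N * D) := by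
        refine Real.le_sqrt_of_sq_le ?_
        rw [← pow_mul]
        exact hf.1.pow_four_le hab.le hx
      have h2 : 0 ≤ (2 * l)⁻¹ * ((V x - m) * f x ^ 2) := by positivity
      linarith
    · rw [indicator_of_notMem hxy, zero_add, inv_mul_eq_div, le_div_iff₀ (by positivity), mul_comm]
      have : m + 2 * l < V x := by
        by_contra! hc
        exact hxy ⟨hx, hc⟩
      exact mul_le_mul_of_nonneg_right (by linarith) (sq_nonneg _)
  have hW0 : 0 ≤ ∫ x in Icc a b, (V x - m) * f x ^ 2 :=
    setIntegral_nonneg measurableSet_Icc fun x hx =>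
      mul_nonneg (sub_nonneg.2 (hm x hx)) (sq_nonneg _)
  have hhalf : (2 * l)⁻¹ * ∫ x in Icc a b, (V x - m) * f x ^ 2 ≤ N / 2 := by
    rw [inv_mul_le_iff₀ (by positivity)]
    linarith
  have hroot : Real.sqrt (N * D) ≤ N * Real.sqrt l := by
    refine Real.sqrt_le_iff.2 ⟨by positivity, ?_⟩
    rw [mul_pow, Real.sq_sqrt hl.le]
    nlinarith
  have hone : 1 ≤ 2 * (w * Real.sqrt l) := by
    have h1 := mul_le_mul_of_nonneg_left hroot hw0
    have h2 : N * 1 ≤ N * (2 * (w * Real.sqrt l)) := by linarith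
    exact le_of_mul_le_mul_left h2 hN0
  have hwpos : 0 < w := by
    refine hw0.lt_of_ne fun h => ?_
    rw [← h] at hone
    norm_num at hone
  have hinv : 1 / w ^ 2 ≤ 4 * l := by
    rw [div_le_iff₀ (by positivity)]
    have h := one_le_pow₀ hone (n := 2)
    rw [mul_pow, mul_pow, Real.sq_sqrt hl.le] at h
    linarith
  have hM : widthMin a b V ≤ 1 / w ^ 2 + (m + 2 * l) :=
    csInf_le bddBelow_widthValues ⟨m + 2 * l, by linarith, hwpos, rfl⟩
  linarith

/-! ### The upper bound -/

/-- The ground state of the Dirichlet Laplacian on `[c, d]`, extended by zero. The argument of the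
sine is clamped to `[c, d]`, which shows at once that the function is Lipschitz. -/
noncomputable def sineBump (c d : ℝ) (x : ℝ) : ℝ :=
  Real.sin (Real.pi / (d - c) * (max c (min x d) - c))

section sineBump

variable {c d : ℝ}

lemma sineBump_eq_indicator (hcd : c < d) :
    sineBump c d = (Ioo c d).indicator fun x => Real.sin (Real.pi / (d - c) * (x - c)) := by
  ext x
  by_cases hx : x ∈ Ioo c d
  · rw [indicator_of_mem hx, sineBump, min_eq_left hx.2.le, max_eq_right hx.1.le]
  · rw [indicator_of_notMem hx, sineBump]
    rcases le_or_gt x c with h | h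
    · rw [min_eq_left (h.trans hcd.le), max_eq_left h]
      simp
    · have hd : d ≤ x := by
        by_contra! hc
        exact hx ⟨h, hc⟩
      rw [min_eq_right hd, max_eq_right hcd.le, div_mul_cancel₀ _ (sub_pos.2 hcd).ne',
        Real.sin_pi]

lemma deriv_sineBump_ae (hcd : c < d) : ∀ᵐ x : ℝ, deriv (sineBump c d) x
    = (Ioo c d).indicator
      (fun x => Real.pi / (d - c) * Real.cos (Real.pi / (d - c) * (x - c))) x := by
  have hne : ∀ p : ℝ, ∀ᵐ x : ℝ, x ≠ p := fun p => by simp [ae_iff, measure_singleton]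
  filter_upwards [hne c, hne d] with x hxc hxd
  by_cases hx : x ∈ Ioo c d
  · rw [indicator_of_mem hx]
    have hev : sineBump c d =ᶠ[𝓝 x] fun x => Real.sin (Real.pi / (d - c) * (x - c)) := by
      filter_upwards [isOpen_Ioo.mem_nhds hx] with z hz
      rw [sineBump_eq_indicator hcd, indicator_of_mem hz]
    rw [hev.deriv_eq]
    have h := (((hasDerivAt_id x).sub_const c).const_mul (Real.pi / (d - c))).sin
    simp only [id, mul_one] at h
    rw [h.deriv, mul_comm]
  · rw [indicator_of_notMem hx]
    have hx' : x ∈ (Icc c d)ᶜ := fun h =>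
      hx ⟨lt_of_le_of_ne h.1 (Ne.symm hxc), lt_of_le_of_ne h.2 hxd⟩
    have hev : sineBump c d =ᶠ[𝓝 x] fun _ => (0 : ℝ) := by
      filter_upwards [isClosed_Icc.isOpen_compl.mem_nhds hx'] with z hz
      rw [sineBump_eq_indicator hcd, indicator_of_notMem fun h => hz ⟨h.1.le, h.2.le⟩]
    rw [hev.deriv_eq]
    simp

lemma lipschitzWith_sineBump :
    LipschitzWith (Real.toNNReal |Real.pi / (d - c)|) (sineBump c d) := by
  refine LipschitzWith.of_dist_le_mul fun x y => ?_
  rw [Real.coe_toNNReal _ (abs_nonneg _), Real.dist_eq, Real.dist_eq]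
  refine (Real.abs_sin_sub_sin_le _ _).trans ?_
  rw [← mul_sub, abs_mul, sub_sub_sub_cancel_right]
  refine mul_le_mul_of_nonneg_left ?_ (abs_nonneg _)
  refine (abs_max_sub_max_le_max _ _ _ _).trans (max_le (by simp) ?_)
  exact (abs_min_sub_min_le_max _ _ _ _).trans (max_le le_rfl (by simp))

lemma integral_comp_scaled_interval (hcd : c < d) (F : ℝ → ℝ) :
    ∫ x in Ioo c d, F (Real.pi / (d - c) * (x - c))
      = (Real.pi / (d - c))⁻¹ * ∫ u in (0 : ℝ)..Real.pi, F u := by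
  have hk : Real.pi / (d - c) ≠ 0 := (div_pos Real.pi_pos (sub_pos.2 hcd)).ne'
  rw [← integral_Ioc_eq_integral_Ioo, ← intervalIntegral.integral_of_le hcd.le,
    intervalIntegral.integral_comp_sub_right (fun x => F (Real.pi / (d - c) * x)) c,
    intervalIntegral.integral_comp_mul_left F hk, smul_eq_mul, sub_self, mul_zero,
    div_mul_cancel₀ _ (sub_pos.2 hcd).ne']

lemma overlap_sineBump (hcd : c < d) (hac : a ≤ c) (hdb : d ≤ b) :
    overlap a b (sineBump c d) (sineBump c d) = (Real.pi / (d - c))⁻¹ * (Real.pi / 2) := by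
  have hsub : Ioo c d ⊆ Icc a b := fun x hx => ⟨hac.trans hx.1.le, hx.2.le.trans hdb⟩
  have e : (fun x => sineBump c d x ^ 2)
      = (Ioo c d).indicator fun x => Real.sin (Real.pi / (d - c) * (x - c)) ^ 2 := by
    rw [sineBump_eq_indicator hcd]
    ext x
    by_cases hx : x ∈ Ioo c d <;> simp [hx]
  rw [overlap_self_eq, e, setIntegral_indicator measurableSet_Ioo,
    inter_eq_self_of_subset_right hsub,
    integral_comp_scaled_interval hcd fun u => Real.sin u ^ 2, integral_sin_sq]
  simp

lemma integral_deriv_sineBump_sq (hcd : c < d) (hac : a ≤ c) (hdb : d ≤ b) :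
    ∫ x in Icc a b, deriv (sineBump c d) x ^ 2
      = (Real.pi / (d - c)) ^ 2 * ((Real.pi / (d - c))⁻¹ * (Real.pi / 2)) := by
  have hsub : Ioo c d ⊆ Icc a b := fun x hx => ⟨hac.trans hx.1.le, hx.2.le.trans hdb⟩
  have e : ∫ x in Icc a b, deriv (sineBump c d) x ^ 2 = ∫ x in Icc a b, (Ioo c d).indicator
      (fun x => (Real.pi / (d - c)) ^ 2 * Real.cos (Real.pi / (d - c) * (x - c)) ^ 2) x := by
    refine integral_congr_ae (ae_restrict_of_ae ?_)
    filter_upwards [deriv_sineBump_ae hcd] with x hx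
    rw [hx]
    by_cases hx : x ∈ Ioo c d <;> simp [hx, mul_pow]
  rw [e, setIntegral_indicator measurableSet_Ioo, inter_eq_self_of_subset_right hsub,
    integral_const_mul, integral_comp_scaled_interval hcd fun u => Real.cos u ^ 2,
    integral_cos_sq]
  simp

/-- If `V` is bounded on `(c, d)`, the bump on `[c, d]` is in the form domain. -/
lemma inFormDomain_sineBump (hV : AEMeasurable V (volume.restrict (Icc a b)))
    {m y : ℝ} (hm : ∀ x ∈ Icc a b, m ≤ V x) (hcd : c < d) (hac : a ≤ c) (hdb : d ≤ b)
    (hy : ∀ x ∈ Ioo c d, V x ≤ y) : InFormDomain a b V (sineBump c d) := by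
  have hout : ∀ x, x ∉ Ioo c d → sineBump c d x = 0 := fun x hx => by
    rw [sineBump_eq_indicator hcd, indicator_of_notMem hx]
  refine ⟨lipschitzWith_sineBump.lipschitzOnWith.absolutelyContinuousOnInterval,
    hout a fun h => (hac.trans_lt h.1).false, hout b fun h => (h.2.trans_le hdb).false, ?_, ?_⟩
  · refine MemLp.of_bound (measurable_deriv _).aestronglyMeasurable |Real.pi / (d - c)|
      (ae_restrict_of_ae ?_)
    filter_upwards [deriv_sineBump_ae hcd] with x hx
    rw [hx, Real.norm_eq_abs]
    by_cases hx : x ∈ Ioo c d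
    · rw [indicator_of_mem hx, abs_mul]
      exact mul_le_of_le_one_right (abs_nonneg _) (Real.abs_cos_le_one _)
    · rw [indicator_of_notMem hx, abs_zero]
      exact abs_nonneg _
  · refine Integrable.of_bound (C := max |m| |y|) (hV.aestronglyMeasurable.mul
      (lipschitzWith_sineBump.continuous.pow 2).aestronglyMeasurable) ?_
    rw [ae_restrict_iff' measurableSet_Icc]
    refine Eventually.of_forall fun x hx => ?_
    by_cases hx' : x ∈ Ioo c d
    · rw [Real.norm_eq_abs, abs_mul]
      have h1 : |V x| ≤ max |m| |y| := abs_le_max_abs_abs (hm x hx) (hy x hx')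
      have h2 : |sineBump c d x ^ 2| ≤ 1 := by
        rw [abs_pow]
        exact pow_le_one₀ (abs_nonneg _) (Real.abs_sin_le_one _)
      exact (mul_le_of_le_one_right (abs_nonneg _) h2).trans h1
    · rw [hout x hx']
      simp

lemma energy_sineBump_le (hab : a ≤ b) (hV : AEMeasurable V (volume.restrict (Icc a b)))
    {m y : ℝ} (hm : ∀ x ∈ Icc a b, m ≤ V x) (hcd : c < d) (hac : a ≤ c) (hdb : d ≤ b)
    (hy : ∀ x ∈ Ioo c d, V x ≤ y) :
    energy a b V (sineBump c d) (sineBump c d)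
      ≤ ((Real.pi / (d - c)) ^ 2 + y) * overlap a b (sineBump c d) (sineBump c d) := by
  have hD := inFormDomain_sineBump hV hm hcd hac hdb hy
  have hpot : ∫ x in Icc a b, V x * sineBump c d x ^ 2
      ≤ y * overlap a b (sineBump c d) (sineBump c d) := by
    rw [overlap_self_eq, ← integral_const_mul]
    refine setIntegral_mono_on hD.potential ((hD.memLp_two hab).integrable_sq.const_mul y)
      measurableSet_Icc fun x _ => ?_
    by_cases hx : x ∈ Ioo c d
    · exact mul_le_mul_of_nonneg_right (hy x hx) (sq_nonneg _)
    · rw [sineBump_eq_indicator hcd, indicator_of_notMem hx]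
      simp
  rw [hD.energy_self_eq, integral_deriv_sineBump_sq hcd hac hdb, add_mul,
    ← overlap_sineBump hcd hac hdb]
  linarith

end sineBump

/-- A sublevel set that is an interval contains an open interval of at least its length. -/
lemma exists_Ioo_subset_sublevel {y : ℝ} (hw : 0 < width a b V y)
    (hS : (sublevel a b V y).OrdConnected) :
    ∃ c d, c < d ∧ a ≤ c ∧ d ≤ b ∧ width a b V y ≤ d - c ∧ ∀ x ∈ Ioo c d, V x ≤ y := by
  set S := sublevel a b V y with hSdef
  have hSsub : S ⊆ Icc a b := fun x hx => hx.1
  have hne : S.Nonempty := by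
    by_contra h
    rw [not_nonempty_iff_eq_empty] at h
    rw [width, ← hSdef, h] at hw
    simp at hw
  have hbb : BddBelow S := bddBelow_Icc.mono hSsub
  have hba : BddAbove S := bddAbove_Icc.mono hSsub
  have hle : width a b V y ≤ sSup S - sInf S := by
    have h1 : volume S ≤ volume (Icc (sInf S) (sSup S)) :=
      measure_mono fun x hx => ⟨csInf_le hbb hx, le_csSup hba hx⟩
    rw [Real.volume_Icc] at h1
    exact ENNReal.toReal_le_of_le_ofReal
      (sub_nonneg.2 (csInf_le_csSup hne hbb hba)) h1
  refine ⟨sInf S, sSup S, by linarith, le_csInf hne fun x hx => (hSsub hx).1,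
    csSup_le hne fun x hx => (hSsub hx).2, hle, fun x hx => ?_⟩
  obtain ⟨s, hs, hsx⟩ := exists_lt_of_csInf_lt hne hx.1
  obtain ⟨t, ht, hxt⟩ := exists_lt_of_lt_csSup hne hx.2
  exact (hS.out hs ht ⟨hsx.le, hxt.le⟩).2

/-- The upper bound, by testing the variational principle with the sine on the sublevel set. -/
theorem sub_infV_le_of_ordConnected (hab : a < b)
    (hV : AEMeasurable V (volume.restrict (Icc a b))) (hVb : BddBelow (V '' Icc a b))
    {lam y : ℝ} (hlam : IsLeast (eigenvalues a b V) lam) (hy : IsMinimizingLevel a b V y)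
    (hS : (sublevel a b V y).OrdConnected) :
    lam - infV a b V ≤ Real.pi ^ 2 * (widthMin a b V - infV a b V) := by
  obtain ⟨hw, hyM⟩ := hy
  have hm : ∀ x ∈ Icc a b, infV a b V ≤ V x := fun x hx => csInf_le hVb (mem_image_of_mem V hx)
  obtain ⟨c, d, hcd, hac, hdb, hwd, hVy⟩ := exists_Ioo_subset_sublevel hw hS
  have hD := inFormDomain_sineBump hV hm hcd hac hdb hVy
  have hk : 0 < Real.pi / (d - c) := div_pos Real.pi_pos (sub_pos.2 hcd)
  have hpos : 0 < overlap a b (sineBump c d) (sineBump c d) := by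
    rw [overlap_sineBump hcd hac hdb]
    exact mul_pos (inv_pos.2 hk) (half_pos Real.pi_pos)
  obtain ⟨l, hl, hray⟩ := exists_isLeast_eigenvalues hab hV hm hD hpos
  rw [hlam.unique hl]
  have h1 : l ≤ (Real.pi / (d - c)) ^ 2 + y :=
    le_of_mul_le_mul_right
      ((hray _ hD).trans (energy_sineBump_le hab.le hV hm hcd hac hdb hVy)) hpos
  have h2 : (Real.pi / (d - c)) ^ 2 ≤ Real.pi ^ 2 * (1 / width a b V y ^ 2) := by
    rw [mul_one_div, ← div_pow]
    gcongr
  have hym : infV a b V ≤ y := by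
    have hx : (c + d) / 2 ∈ Ioo c d := ⟨by linarith, by linarith⟩
    exact (hm _ ⟨hac.trans hx.1.le, hx.2.le.trans hdb⟩).trans (hVy _ hx)
  have hpi : 1 ≤ Real.pi ^ 2 := one_le_pow₀ (by linarith [Real.pi_gt_three])
  have h3 : y - infV a b V ≤ Real.pi ^ 2 * (y - infV a b V) :=
    le_mul_of_one_le_left (sub_nonneg.2 hym) hpi
  rw [← hyM]
  linarith

/-! ### The sup norm of normalized eigenfunctions -/

lemma IsEigenfunction.abs_le_rpow {μ : ℝ} (hab : a ≤ b) (hV0 : ∀ x ∈ Icc a b, 0 ≤ V x)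
    (hf : IsEigenfunction a b V μ f) (hf1 : ∫ x in Icc a b, f x ^ 2 = 1) {x : ℝ}
    (hx : x ∈ Icc a b) : |f x| ≤ (2 * μ) ^ (1 / 4 : ℝ) := by
  rw [← overlap_self_eq] at hf1
  have h1 := hf.1.pow_four_le hab hx
  have h2 := hf.1.integral_deriv_sq_add_le_energy hab hV0
  rw [hf.energy_self, hf1] at h2
  rw [hf1] at h1
  have h3 : |f x| ^ 4 ≤ 2 * μ := by
    rw [Even.pow_abs (by decide)]
    have := (hf.integral_deriv_sq_pos hab).le
    linarith
  calc |f x| = (|f x| ^ 4) ^ (1 / 4 : ℝ) := by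
        rw [← Real.rpow_natCast, ← Real.rpow_mul (abs_nonneg _)]
        norm_num
    _ ≤ (2 * μ) ^ (1 / 4 : ℝ) := by gcongr

end DirichletSchrodinger

theorem theorem1 (a b : ℝ) (hab : a < b) (V : ℝ → ℝ)
    (hVmeas : AEMeasurable V (volume.restrict (Icc a b)))
    (hVbdd : BddBelow (V '' Icc a b)) :
    -- a smallest eigenvalue exists, unless the form domain is trivial
    ((∃ f, DirichletSchrodinger.InFormDomain a b V f ∧ ∃ x ∈ Icc a b, f x ≠ 0) →
      ∃ lam : ℝ, IsLeast (DirichletSchrodinger.eigenvalues a b V) lam) ∧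
    ∀ lam : ℝ, IsLeast (DirichletSchrodinger.eigenvalues a b V) lam →
      -- the two bounds for a nonnegative potential, and the bound on normalized ground states
      ((∀ x ∈ Icc a b, 0 ≤ V x) →
        (1 / 250) * DirichletSchrodinger.widthMin a b V ≤ lam ∧
        (∀ y : ℝ, DirichletSchrodinger.IsMinimizingLevel a b V y →
          (DirichletSchrodinger.sublevel a b V y).OrdConnected →
          lam ≤ Real.pi ^ 2 * DirichletSchrodinger.widthMin a b V) ∧
        (∀ f : ℝ → ℝ, DirichletSchrodinger.IsEigenfunction a b V lam f →
          ∫ x in Icc a b, f x ^ 2 = 1 →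
          ∀ x ∈ Icc a b, |f x| ≤ (2 * lam) ^ (1 / 4 : ℝ))) ∧
      -- the two bounds for an arbitrary potential bounded below, measured from `inf V`
      (1 / 250) * (DirichletSchrodinger.widthMin a b V - DirichletSchrodinger.infV a b V) ≤
        lam - DirichletSchrodinger.infV a b V ∧
      (∀ y : ℝ, DirichletSchrodinger.IsMinimizingLevel a b V y →
        (DirichletSchrodinger.sublevel a b V y).OrdConnected →
        lam - DirichletSchrodinger.infV a b V ≤
          Real.pi ^ 2 *
            (DirichletSchrodinger.widthMin a b V - DirichletSchrodinger.infV a b V)) := by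
  have hm : ∀ x ∈ Icc a b, DirichletSchrodinger.infV a b V ≤ V x :=
    fun x hx => csInf_le hVbdd (mem_image_of_mem V hx)
  refine ⟨?_, fun lam hlam => ?_⟩
  · rintro ⟨g, hg, x, hx, hgx⟩
    obtain ⟨lam, hlam, -⟩ := DirichletSchrodinger.exists_isLeast_eigenvalues hab hVmeas hm hg
      (hg.overlap_self_pos hab hx hgx)
    exact ⟨lam, hlam⟩
  · have hlow := DirichletSchrodinger.widthMin_sub_infV_le hab hVmeas hVbdd hlam.1
    have hpos := DirichletSchrodinger.infV_lt_of_mem_eigenvalues hab hVbdd hlam.1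
    refine ⟨fun hV0 => ?_, by linarith, fun y hy hS =>
      DirichletSchrodinger.sub_infV_le_of_ordConnected hab hVmeas hVbdd hlam hy hS⟩
    have hm0 : 0 ≤ DirichletSchrodinger.infV a b V := by
      refine le_csInf ((nonempty_Icc.2 hab.le).image V) ?_
      rintro _ ⟨x, hx, rfl⟩
      exact hV0 x hx
    refine ⟨by linarith, fun y hy hS => ?_, fun f hf hf1 x hx => hf.abs_le_rpow hab.le hV0 hf1 hx⟩
    have hup := DirichletSchrodinger.sub_infV_le_of_ordConnected hab hVmeas hVbdd hlam hy hS
    have hpi : 1 ≤ Real.pi ^ 2 := one_le_pow₀ (by linarith [Real.pi_gt_three])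
    have := le_mul_of_one_le_left hm0 hpi
    linarith
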